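/- Let $T$ be a bounded self-adjoint operator on a complex Hilbert space $\mathcal H$. For $t\in\mathbb R$, say that $T$ is the pencil of a pair of projections at $t$ if $T=tP+Q$ for some nonzero orthogonal projections $P,Q$ on $\mathcal H$. Write $\sigma(T)$ for the spectrum and $\mathcal N(\cdot)$ for the null space of an operator, and let $\dim$ denote Hilbert space dimension (the cardinality of an orthonormal basis). There are nonzero real numbers $\lambda,\mu$ with $|\lambda-\mu|=\frac12$, $\max\{\lambda,\mu\}\neq 1$ and $\min\{\lambda,\mu\}\neq -1$ such that $T$ is the pencil of a pair of projections at $\lambda$ and also the pencil of a (possibly different) pair of projections at $\mu$, if and only if one of the following holds: a) for some real $z>\frac12$, $\{\frac12,\frac12+z,1+z\}\subseteq\sigma(T)\subseteq\{\frac12,\frac12+z,1+z,0,1\}$ and $\dim\mathcal N(T-\frac12 I)=\dim\mathcal N(T-(\frac12+z)I)=\dim\mathcal N(T-(1+z)I)$; b) for some real $z<-\frac12$, $\{\frac12,z,\frac12+z\}\subseteq\sigma(T)\subseteq\{\frac12,z,\frac12+z,0,1\}$ and $\dim\mathcal N(T-\frac12 I)=\dim\mathcal N(T-(\frac12+z)I)=\dim\mathcal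 N(T-zI)$. In this case, there are exactly two real numbers at which $T$ is the pencil of a pair of projections. -/

import Mathlib

open scoped Cardinal

universe u

/-- `T` is the pencil at the real number `t` of some pair of projections: `T = t P + Q` for two
nonzero orthogonal projections `P` and `Q` on `H`. -/
def IsPencilAt {H : Type u} [NormedAddCommGroup H] [InnerProductSpace ℂ H] [CompleteSpace H]
    (T : H →L[ℂ] H) (t : ℝ) : Prop :=
  ∃ P Q : H →L[ℂ] H, IsStarProjection P ∧ IsStarProjection Q ∧ P ≠ 0 ∧ Q ≠ 0 ∧
    T = (t : ℂ) • P + Q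

/-- The Hilbert space dimension of `K`: the cardinality of an orthonormal (Hilbert) basis.
All orthonormal bases of a Hilbert space have the same cardinality, so the infimum is taken over
a set with exactly one element. (The algebraic `Module.rank` would be a different cardinal for
infinite-dimensional `K`.) -/
noncomputable def hilbertDim (K : Type u) [NormedAddCommGroup K] [InnerProductSpace ℂ K] :
    Cardinal.{u} :=
  sInf {c | ∃ ι : Type u, Nonempty (HilbertBasis ι ℂ K) ∧ #ι = c}

/-- The Hilbert space dimension of the null space of `T - x I`, for a real number `x`. -/
noncomputable def nullDim {H : Type u} [NormedAddCommGroup H] [InnerProductSpace ℂ H]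
    (T : H →L[ℂ] H) (x : ℝ) : Cardinal.{u} :=
  hilbertDim (T - (x : ℂ) • ContinuousLinearMap.id ℂ H).ker

/-! For `T = tP + Q` the commutator `W = PQ - QP` intertwines `T` with `1 + t - T`, and `t² W*W =
T(1+t-T)(T-1)(T-t)`. So away from `0, 1, t, 1+t` the spectrum is symmetric under `x ↦ 1+t-x`
(`one_add_sub_mem_spectrum_pencil`), and a multiple of `W` identifies eigenspaces at mirror points
(`nullDim_pencil_eq`). Also `T(1+t-T) = t(P-Q)²`, which bounds the spectrum
(`mem_Icc_of_mem_spectrum_pencil`).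

Two parameters at distance `1/2` give two reflections whose composite is a translation by `1/2`.
With the bounds, this leaves only the listed spectra or a subset of `{0, 1}`
(`IsPencilSet.subset_or_of_pos` and its variants). The latter makes `T` idempotent, hence `P = 0`
unless `t` is `0` or `±1`.

Conversely, `isPencilAt_of_spectrum_subset` writes `P` and `Q` as `2 × 2` blocks over the
eigenspaces at `1/2` and `1/2 + t`, identified by a partial isometry. No third parameter occurs,
since its reflection would have to respect the three points (`IsPencilSet.eq_or_eq_of_pos`). -/

/-! ### Algebraic identities for a pencil of idempotents -/

theorem IsIdempotentElem.commutator_mul_pencil {A : Type*} [Ring A] [Algebra ℂ A] {P Q : A}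
    (hP : P * P = P) (hQ : Q * Q = Q) (t : ℂ) :
    (P * Q - Q * P) * (t • P + Q) = ((1 + t) • 1 - (t • P + Q)) * (P * Q - Q * P) := by
  have hP' : ∀ x, P * (P * x) = P * x := fun x => by rw [← mul_assoc, hP]
  have hQ' : ∀ x, Q * (Q * x) = Q * x := fun x => by rw [← mul_assoc, hQ]
  simp only [mul_add, add_mul, mul_sub, sub_mul, smul_mul_assoc, mul_smul_comm, mul_assoc, hP, hQ,
    hP', hQ', one_mul]
  module

theorem IsIdempotentElem.smul_commutator_mul_commutator {A : Type*} [Ring A] [Algebra ℂ A]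
    {P Q : A} (hP : P * P = P) (hQ : Q * Q = Q) (t : ℂ) :
    t ^ 2 • ((Q * P - P * Q) * (P * Q - Q * P)) =
      (t • P + Q) * ((1 + t) • 1 - (t • P + Q)) * ((t • P + Q - 1) * (t • P + Q - t • 1)) := by
  have hP' : ∀ x, P * (P * x) = P * x := fun x => by rw [← mul_assoc, hP]
  have hQ' : ∀ x, Q * (Q * x) = Q * x := fun x => by rw [← mul_assoc, hQ]
  simp only [mul_add, add_mul, mul_sub, sub_mul, smul_mul_assoc, mul_smul_comm, mul_assoc, hP, hQ,
    hP', hQ', one_mul, mul_one, smul_add, smul_sub]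
  module

theorem IsIdempotentElem.pencil_mul_reflect {A : Type*} [Ring A] [Algebra ℂ A]
    {P Q : A} (hP : P * P = P) (hQ : Q * Q = Q) (t : ℂ) :
    (t • P + Q) * ((1 + t) • 1 - (t • P + Q)) = t • (P - Q) ^ 2 := by
  simp only [pow_two, mul_add, add_mul, mul_sub, sub_mul, smul_mul_assoc, mul_smul_comm, hP, hQ,
    mul_one, smul_sub]
  module

/-! ### Spectral constraints on a pencil -/

section CStar
variable {A : Type*} [CStarAlgebra A]

theorem exists_real_of_mem_spectrum {T : A} (hT : IsSelfAdjoint T) {w : ℂ}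
    (hw : w ∈ spectrum ℂ T) : ∃ x : ℝ, w = x :=
  ⟨w.re, hT.mem_spectrum_eq_re hw⟩

open Polynomial in
-- If `1+t-x-T` were invertible, the intertwining relation would make `W`, hence the quartic `p(T) =
-- t² W'W`, a left multiple of `T - x`. As `p(T) - p(x)` is one too and `p(x) ≠ 0`, `T - x` would be
-- left invertible.
theorem one_add_sub_mem_spectrum_pencil {P Q : A} (hP : IsStarProjection P)
    (hQ : IsStarProjection Q) {t x : ℝ} (hx : (x : ℂ) ∈ spectrum ℂ ((t : ℂ) • P + Q))
    (hp : x * (1 + t - x) * ((x - 1) * (x - t)) ≠ 0) :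
    ((1 + t - x : ℝ) : ℂ) ∈ spectrum ℂ ((t : ℂ) • P + Q) := by
  set T := (t : ℂ) • P + Q with hTdef
  have hT : IsSelfAdjoint T := by
    refine IsSelfAdjoint.add ?_ hQ.isSelfAdjoint
    exact IsSelfAdjoint.smul (by simp [IsSelfAdjoint]) hP.isSelfAdjoint
  have h1 := IsIdempotentElem.commutator_mul_pencil hP.isIdempotentElem hQ.isIdempotentElem (t : ℂ)
  have h2 := IsIdempotentElem.smul_commutator_mul_commutator hP.isIdempotentElem
    hQ.isIdempotentElem (t : ℂ)
  rw [← hTdef] at h1 h2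
  generalize P * Q - Q * P = W at h1 h2
  generalize Q * P - P * Q = W' at h2
  by_contra hn
  rw [spectrum.notMem_iff] at hn
  obtain ⟨R, hR⟩ := hn.exists_left_inv
  apply hx
  set p : ℂ[X] := X * (C (1 + (t : ℂ)) - X) * ((X - 1) * (X - C (t : ℂ)))
  obtain ⟨q, hq⟩ := X_sub_C_dvd_sub_C_eval (a := (x : ℂ)) (p := p)
  have hpT : aeval T p = (t : ℂ) ^ 2 • (W' * W) := by
    rw [h2]; simp [p, Algebra.algebraMap_eq_smul_one, add_smul, -Complex.coe_smul]
  have hpx : p.eval (x : ℂ) = ((x * (1 + t - x) * ((x - 1) * (x - t)) : ℝ) : ℂ) := by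
    simp [p]
  have hqT : aeval T p - algebraMap ℂ A (p.eval (x : ℂ)) =
      aeval T q * (T - algebraMap ℂ A x) := by
    rw [← (aeval T).commutes] at *
    have := congrArg (aeval T) hq
    rw [mul_comm] at this
    simpa using this
  have hW : W = R * W * (T - algebraMap ℂ A x) := by
    have : (algebraMap ℂ A ((1 + t - x : ℝ) : ℂ) - T) * W = W * (T - algebraMap ℂ A x) := by
      rw [mul_sub, h1]
      simp only [Algebra.algebraMap_eq_smul_one, sub_mul, mul_smul_comm, smul_mul_assoc, one_mul,
        mul_one]
      push_cast
      module
    rw [mul_assoc, ← this, ← mul_assoc, hR, one_mul]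
  set c := x * (1 + t - x) * ((x - 1) * (x - t))
  have hc : (c : ℂ) ≠ 0 := by exact_mod_cast hp
  have hleft : ((c : ℂ)⁻¹ • (aeval T q - (t : ℂ) ^ 2 • (W' * R * W))) *
      (algebraMap ℂ A x - T) = 1 := by
    have : (aeval T q - (t : ℂ) ^ 2 • (W' * R * W)) * (algebraMap ℂ A x - T) =
        algebraMap ℂ A c := by
      have e : W' * W = W' * R * W * (T - algebraMap ℂ A x) := by
        conv_lhs => rw [hW]
        simp only [mul_assoc]
      rw [← neg_sub T, mul_neg, sub_mul, ← hqT, hpT, hpx, e]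
      simp only [smul_mul_assoc]
      abel
    rw [smul_mul_assoc, this, Algebra.algebraMap_eq_smul_one, smul_smul, inv_mul_cancel₀ hc,
      one_smul]
  -- `x - T` is self-adjoint, so the adjoint of a left inverse is a right inverse.
  have hsa : star (algebraMap ℂ A x - T) = algebraMap ℂ A x - T := by
    rw [star_sub, hT.star_eq, ← algebraMap_star_comm]; simp
  have hright := congrArg star hleft
  rw [star_mul, hsa, star_one] at hright
  exact isUnit_iff_exists_and_exists.2 ⟨⟨_, hright⟩, ⟨_, hleft⟩⟩

open Polynomial in
theorem nonneg_of_mem_spectrum_sq {B : A} (hB : IsSelfAdjoint B) {y : ℝ}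
    (hy : (y : ℂ) ∈ spectrum ℂ (B ^ 2)) : 0 ≤ y := by
  have h := spectrum.map_polynomial_aeval_of_nonempty (𝕜 := ℂ) B (X ^ 2)
    (by by_contra h
        rw [Set.not_nonempty_iff_eq_empty] at h
        rcases subsingleton_or_nontrivial A with hA | hA
        · simp [spectrum.of_subsingleton] at hy
        · exact (spectrum.nonempty B).ne_empty h)
  simp only [map_pow, aeval_X, eval_pow, eval_X] at h
  rw [h] at hy
  obtain ⟨w, hw, hwy⟩ := hy
  obtain ⟨r, rfl⟩ := exists_real_of_mem_spectrum hB hw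
  have : r ^ 2 = y := by
    have h : (r : ℂ) ^ 2 = y := hwy
    exact_mod_cast h
  rw [← this]; positivity

open Polynomial in
-- `(P-Q)²` and `(1-P-Q)²` are squares of self-adjoint elements, are polynomials in `T`, and sum to
-- `1`; each supplies one bound.
theorem mem_Icc_of_mem_spectrum_pencil {P Q : A} (hP : IsStarProjection P)
    (hQ : IsStarProjection Q) {t x : ℝ} (ht : t ≠ 0)
    (hx : (x : ℂ) ∈ spectrum ℂ ((t : ℂ) • P + Q)) :
    x * (1 + t - x) / t ∈ Set.Icc (0 : ℝ) 1 := by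
  have ht' : (t : ℂ) ≠ 0 := by exact_mod_cast ht
  have h0 := IsIdempotentElem.pencil_mul_reflect hP.isIdempotentElem hQ.isIdempotentElem (t : ℂ)
  have hD : (P - Q) ^ 2 = aeval ((t : ℂ) • P + Q)
      (C (t : ℂ)⁻¹ * (X * (C (1 + (t : ℂ)) - X))) := by
    simp only [map_mul, aeval_C, aeval_X, map_sub, Algebra.algebraMap_eq_smul_one, h0]
    rw [smul_mul_assoc, one_mul, smul_smul, inv_mul_cancel₀ ht', one_smul]
  have hE : (1 - P - Q) ^ 2 = aeval ((t : ℂ) • P + Q)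
      (1 - C (t : ℂ)⁻¹ * (X * (C (1 + (t : ℂ)) - X))) := by
    rw [map_sub, ← hD, map_one]
    have hP2 : P * P = P := hP.isIdempotentElem
    have hQ2 : Q * Q = Q := hQ.isIdempotentElem
    simp only [pow_two, mul_sub, sub_mul, hP2, hQ2, one_mul, mul_one]
    abel
  have key (p : ℂ[X]) : p.eval (x : ℂ) ∈ spectrum ℂ (aeval ((t : ℂ) • P + Q) p) :=
    spectrum.subset_polynomial_aeval _ p ⟨_, hx, rfl⟩
  have e1 := key (C (t : ℂ)⁻¹ * (X * (C (1 + (t : ℂ)) - X)))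
  have e2 := key (1 - C (t : ℂ)⁻¹ * (X * (C (1 + (t : ℂ)) - X)))
  rw [← hD] at e1
  rw [← hE] at e2
  have f1 := nonneg_of_mem_spectrum_sq (hP.isSelfAdjoint.sub hQ.isSelfAdjoint)
    (y := x * (1 + t - x) / t) (by convert e1 using 1; simp; ring)
  have f2 := nonneg_of_mem_spectrum_sq
    (((IsSelfAdjoint.one A).sub hP.isSelfAdjoint).sub hQ.isSelfAdjoint)
    (y := 1 - x * (1 + t - x) / t) (by convert e2 using 1; simp; ring)
  exact ⟨f1, by linarith⟩

/-- A set of reals that is, away from `0, 1, t, 1 + t`, symmetric about `(1 + t) / 2` and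
constrained as the spectrum of `t P + Q` is. -/
def IsPencilSet (S : Set ℝ) (t : ℝ) : Prop :=
  ∀ x ∈ S, x ≠ 0 → x ≠ 1 → x ≠ t → x ≠ 1 + t →
    1 + t - x ∈ S ∧ 0 < x * (1 + t - x) / t ∧ x * (1 + t - x) / t < 1

theorem isPencilSet_spectrum {P Q : A} (hP : IsStarProjection P)
    (hQ : IsStarProjection Q) {t : ℝ} (ht : t ≠ 0) :
    IsPencilSet {x | (x : ℂ) ∈ spectrum ℂ ((t : ℂ) • P + Q)} t := by
  intro x hx h0 h1 ht1 ht2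
  have hr : 1 + t - x ≠ 0 := fun h => ht2 (by linarith)
  have hb := mem_Icc_of_mem_spectrum_pencil hP hQ ht hx
  refine ⟨one_add_sub_mem_spectrum_pencil hP hQ hx ?_, lt_of_le_of_ne hb.1 ?_,
    lt_of_le_of_ne hb.2 ?_⟩
  · exact mul_ne_zero (mul_ne_zero h0 hr) (mul_ne_zero (sub_ne_zero.2 h1) (sub_ne_zero.2 ht1))
  · exact (div_ne_zero (mul_ne_zero h0 hr) ht).symm
  · intro h
    rw [div_eq_one_iff_eq ht] at h
    have : (x - 1) * (x - t) = 0 := by linarith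
    rcases mul_eq_zero.1 this with h | h
    · exact h1 (by linarith)
    · exact ht1 (by linarith)

/-- Idempotency gives `(t-1)P + PQ + QP = 0`. Multiplying by `P` on either side shows that `P` and
`Q` commute, so `PQ = ((1-t)/2)P`; then `PQQ = PQ` forces `(1-t)/2` to be `0` or `1` unless `P = 0`.
-/
theorem left_eq_zero_of_isIdempotentElem_pencil {P Q : A} (hP : IsStarProjection P)
    (hQ : IsStarProjection Q) {t : ℝ} (h0 : t ≠ 0) (h1 : t ≠ 1) (h2 : t ≠ -1)
    (hT : IsIdempotentElem ((t : ℂ) • P + Q)) : P = 0 := by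
  have hP2 : P * P = P := hP.isIdempotentElem
  have hQ2 : Q * Q = Q := hQ.isIdempotentElem
  have ht0 : (t : ℂ) ≠ 0 := by exact_mod_cast h0
  -- `(t - 1) P + P Q + Q P = 0`
  have e : ((t : ℂ) - 1) • P + (P * Q + Q * P) = 0 := by
    have h := hT.eq
    simp only [mul_add, add_mul, smul_mul_assoc, mul_smul_comm, hP2, hQ2] at h
    have h' : (t : ℂ) • (((t : ℂ) - 1) • P + (P * Q + Q * P)) = 0 := by
      have := sub_eq_zero.2 h
      rw [← this]; module
    exact (smul_eq_zero.1 h').resolve_left ht0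
  have hP' : ∀ x, P * (P * x) = P * x := fun x => by rw [← mul_assoc, hP2]
  have eL : ((t : ℂ) - 1) • P + P * Q + P * Q * P = 0 := by
    have := congrArg (P * ·) e
    simp only [mul_add, mul_smul_comm, hP2, hP', mul_zero] at this
    rw [← this, mul_assoc]; module
  have eR : ((t : ℂ) - 1) • P + Q * P + P * Q * P = 0 := by
    have := congrArg (· * P) e
    simp only [add_mul, smul_mul_assoc, hP2, mul_assoc, zero_mul] at this
    rw [← this, mul_assoc]; module
  have hc : P * Q = Q * P := by
    have : P * Q - Q * P = (((t : ℂ) - 1) • P + P * Q + P * Q * P) -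
      (((t : ℂ) - 1) • P + Q * P + P * Q * P) := by abel
    rw [eL, eR, sub_zero] at this
    exact sub_eq_zero.1 this
  have hPQ : P * Q = ((1 - (t : ℂ)) / 2) • P := by
    rw [← hc] at e
    have : P * Q = (1 / 2 : ℂ) • (((t : ℂ) - 1) • P + (P * Q + P * Q)) +
      ((1 - (t : ℂ)) / 2) • P := by module
    rw [this, e, smul_zero, zero_add]
  have hPQQ : P * Q * Q = P * Q := by rw [mul_assoc, hQ2]
  rw [hPQ, smul_mul_assoc, hPQ, smul_smul, ← sub_eq_zero, ← sub_smul] at hPQQ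
  refine (smul_eq_zero.1 hPQQ).resolve_left fun h => ?_
  have h' : (1 - t) * (1 + t) = 0 := by
    have : (((1 - t) * (1 + t) : ℝ) : ℂ) = 0 := by push_cast; linear_combination (-4) * h
    exact_mod_cast this
  rcases mul_eq_zero.1 h' with h | h
  · exact h1 (by linarith)
  · exact h2 (by linarith)

theorem isIdempotentElem_of_spectrum_subset {T : A} (hT : IsSelfAdjoint T)
    (h : spectrum ℂ T ⊆ {0, 1}) : IsIdempotentElem T := by
  exact (isIdempotentElem_iff_spectrum_subset ℂ T hT.isStarNormal).2 h

end CStar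

/-! ### Combinatorics of the reflections -/

/-- Shadow of `1 - (tP + Q) = (-t)P + (1 - Q)`; it reduces negative parameters to positive ones. -/
theorem IsPencilSet.one_sub {S : Set ℝ} {t : ℝ} (ht : t ≠ 0) (h : IsPencilSet S t) :
    IsPencilSet {x | 1 - x ∈ S} (-t) := by
  intro x hx h0 h1 h2 h3
  obtain ⟨a, b, c⟩ := h (1 - x) hx (fun h => h1 (by linarith)) (fun h => h0 (by linarith))
    (fun h => h3 (by linarith)) (fun h => h2 (by linarith))
  have e : x * (1 + -t - x) / -t = 1 - (1 - x) * (1 + t - (1 - x)) / t := by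
    field_simp; ring
  refine ⟨?_, by rw [e]; linarith, by rw [e]; linarith⟩
  show 1 - (1 + -t - x) ∈ S
  convert a using 1; ring

theorem IsPencilSet.bounds_of_pos {S : Set ℝ} {t x : ℝ} (ht : 0 < t) (h : IsPencilSet S t)
    (hx : x ∈ S) (h0 : x ≠ 0) (h1 : x ≠ 1) (h2 : x ≠ t) (h3 : x ≠ 1 + t) :
    1 + t - x ∈ S ∧ 0 < x ∧ x < 1 + t ∧ (x < 1 ∧ x < t ∨ 1 < x ∧ t < x) := by
  obtain ⟨a, b, c⟩ := h x hx h0 h1 h2 h3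
  rw [lt_div_iff₀ ht, zero_mul] at b
  rw [div_lt_one ht] at c
  have hb : 0 < x ∧ x < 1 + t := by
    rcases mul_pos_iff.1 b with h | h
    · exact ⟨h.1, by linarith [h.2]⟩
    · exact absurd h.2 (by linarith [h.1])
  refine ⟨a, hb.1, hb.2, ?_⟩
  -- The upper bound rearranges, since `t - x(1+t-x) = (x-1)(x-t)`.
  have : 0 < (x - 1) * (x - t) := by linarith
  rcases mul_pos_iff.1 this with h | h
  · exact Or.inr ⟨by linarith [h.1], by linarith [h.2]⟩
  · exact Or.inl ⟨by linarith [h.1], by linarith [h.2]⟩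

theorem IsPencilSet.bounds_of_neg {S : Set ℝ} {t x : ℝ} (ht : t < 0) (h : IsPencilSet S t)
    (hx : x ∈ S) (h0 : x ≠ 0) (h1 : x ≠ 1) (h2 : x ≠ t) (h3 : x ≠ 1 + t) :
    1 + t - x ∈ S ∧ t < x ∧ x < 1 ∧ (x < 0 ∧ x < 1 + t ∨ 0 < x ∧ 1 + t < x) := by
  have := (h.one_sub ht.ne).bounds_of_pos (x := 1 - x) (by linarith) (by simpa using hx)
    (fun h => h1 (by linarith)) (fun h => h0 (by linarith))
    (fun h => h3 (by linarith)) (fun h => h2 (by linarith))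
  obtain ⟨a, b, c, d⟩ := this
  refine ⟨?_, by linarith, by linarith, ?_⟩
  · rw [Set.mem_ofPred_eq] at a
    convert a using 1; ring
  rcases d with d | d
  · exact Or.inr ⟨by linarith, by linarith⟩
  · exact Or.inl ⟨by linarith, by linarith⟩

/-- Reflecting for `l + 1/2` and then for `l` sends `x` to `x - 1/2`. A low point below `1/2` would
become negative, and one above `1/2` would land on a low point below `1/2`; so `1/2` is the only low
point, and the high points are its mirror images. -/
theorem IsPencilSet.subset_or_of_pos {S : Set ℝ} {l : ℝ} (hl : 0 < l) (hm : l + 1 / 2 ≠ 1)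
    (h : IsPencilSet S l) (h' : IsPencilSet S (l + 1 / 2)) :
    S ⊆ {0, 1} ∨ 1 / 2 < l ∧ {1 / 2, 1 / 2 + l, 1 + l} ⊆ S ∧
      S ⊆ {1 / 2, 1 / 2 + l, 1 + l, 0, 1} := by
  have hl2 : l ≠ 1 / 2 := fun h => hm (by linarith)
  have B := fun x hx => h.bounds_of_pos (x := x) hl hx
  have B' := fun x hx => h'.bounds_of_pos (x := x) (by linarith) hx
  -- low points of `S` for `l`
  have low1 : ∀ x ∈ S, 0 < x → x < 1 → x < l → 1 / 2 ≤ x := by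
    intro x hx h0 h1 h2
    by_contra! h3
    obtain ⟨a, -⟩ := B' x hx (by linarith) (by linarith) (by linarith) (by linarith)
    obtain ⟨b, -⟩ := B _ a (by linarith) (by intro; linarith) (by intro; linarith)
      (by intro; linarith)
    have := B _ b
    grind
  have low2 : ∀ x ∈ S, 0 < x → x < 1 → x < l → x = 1 / 2 := by
    intro x hx h0 h1 h2
    by_contra h3
    have h4 := lt_of_le_of_ne (low1 x hx h0 h1 h2) (Ne.symm h3)
    obtain ⟨a, -⟩ := B' x hx (by linarith) (by linarith) (by linarith) (by linarith)
    obtain ⟨b, -⟩ := B _ a (by linarith) (by intro; linarith) (by intro; linarith)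
      (by intro; linarith)
    have := low1 _ b (by linarith) (by linarith) (by linarith)
    linarith
  have all : ∀ x ∈ S, x ≠ 0 → x ≠ 1 → x ≠ l → x ≠ 1 + l →
      1 / 2 < l ∧ (x = 1 / 2 ∨ x = 1 / 2 + l) := by
    intro x hx h0 h1 h2 h3
    obtain ⟨a, b, c, d⟩ := B x hx h0 h1 h2 h3
    rcases d with d | d
    · have := low2 x hx b d.1 d.2
      exact ⟨by linarith, Or.inl this⟩
    · have := low2 _ a (by linarith) (by linarith) (by linarith)
      exact ⟨by linarith, Or.inr (by linarith)⟩
  -- The point `l` is exceptional for its own reflection, but that of `l + 1/2` sends it to `3/2`,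
  -- which fits no admissible position.
  have hlS : l ∈ S → l = 1 := by
    intro hS
    by_contra h1
    obtain ⟨a, -, -, b⟩ := B' l hS hl.ne' h1 (by linarith) (by linarith)
    have := all _ a (by linarith)
    grind
  by_cases hS : (1 / 2 : ℝ) ∈ S
  · have h1 := B _ hS (by norm_num) (by norm_num) (by grind) (by intro; linarith)
    have h2 := B' _ hS (by norm_num) (by norm_num) (by intro; linarith) (by intro; linarith)
    have hl3 : 1 / 2 < l := by grind
    refine Or.inr ⟨hl3, ?_, ?_⟩
    · rintro x (rfl | rfl | rfl)
      · exact hS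
      · convert h1.1 using 1; ring
      · convert h2.1 using 1; ring
    · intro x hx
      have := all x hx
      simp only [Set.mem_insert_iff, Set.mem_singleton_iff]
      grind
  · left
    intro x hx
    simp only [Set.mem_insert_iff, Set.mem_singleton_iff]
    by_contra! hne
    by_cases e1 : x = l
    · subst e1; exact hne.2 (hlS hx)
    by_cases e2 : x = 1 + l
    · obtain ⟨a, -⟩ := B' x hx hne.1 hne.2 (by linarith) (by linarith)
      exact hS (by convert a using 1; linarith)
    rcases all x hx hne.1 hne.2 e1 e2 with ⟨h2, rfl | rfl⟩
    · exact hS hx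
    · obtain ⟨a, -⟩ := B _ hx hne.1 hne.2 e1 e2
      exact hS (by convert a using 1; linarith)

theorem IsPencilSet.subset_or_of_neg {S : Set ℝ} {m : ℝ} (hm : m < 0) (hl : m - 1 / 2 ≠ -1)
    (h : IsPencilSet S m) (h' : IsPencilSet S (m - 1 / 2)) :
    S ⊆ {0, 1} ∨ m < -(1 / 2) ∧ {1 / 2, m, 1 / 2 + m} ⊆ S ∧
      S ⊆ {1 / 2, m, 1 / 2 + m, 0, 1} := by
  have h1' := h'.one_sub (by linarith)
  rw [show -(m - 1 / 2) = -m + 1 / 2 by ring] at h1'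
  rcases IsPencilSet.subset_or_of_pos (l := -m) (by linarith) (fun h => hl (by linarith))
    (h.one_sub hm.ne) h1' with h2 | ⟨h2, h3, h4⟩
  · left
    intro x hx
    have := @h2 (1 - x) (by simpa using hx)
    simp only [Set.mem_insert_iff, Set.mem_singleton_iff] at this ⊢
    grind
  · refine Or.inr ⟨by linarith, ?_, ?_⟩
    · have e1 := @h3 (1 / 2) (by simp)
      have e2 := @h3 (1 / 2 + -m) (by simp)
      have e3 := @h3 (1 + -m) (by simp)
      simp only [Set.mem_ofPred_eq] at e1 e2 e3
      rintro x (rfl | rfl | rfl)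
      · convert e1 using 1; ring
      · convert e3 using 1; ring
      · convert e2 using 1; ring
    · intro x hx
      have := @h4 (1 - x) (by simpa using hx)
      simp only [Set.mem_insert_iff, Set.mem_singleton_iff] at this ⊢
      grind

/-- A point exceptional for neither parameter would lie above `1 + l` and below `l + 1/2`; the
exceptional points of one parameter violate the bounds of the other. -/
theorem IsPencilSet.subset_of_neg_of_pos {S : Set ℝ} {l : ℝ} (hl : l < 0) (hm : 0 < l + 1 / 2)
    (h : IsPencilSet S l) (h' : IsPencilSet S (l + 1 / 2)) : S ⊆ {0, 1} := by
  intro x hx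
  simp only [Set.mem_insert_iff, Set.mem_singleton_iff]
  by_contra! hne
  have h1 := h.bounds_of_neg hl hx hne.1 hne.2
  have h2 := h'.bounds_of_pos hm hx hne.1 hne.2
  grind

/-- The reflection permutes the unexceptional points without fixed points, so the three given points
cannot all be unexceptional; a finite case check remains. -/
theorem IsPencilSet.eq_or_eq_of_pos {S : Set ℝ} {t z : ℝ} (ht : t ≠ 0) (hz : 1 / 2 < z)
    (h : IsPencilSet S t) (hS : {1 / 2, 1 / 2 + z, 1 + z} ⊆ S)
    (hS' : S ⊆ {1 / 2, 1 / 2 + z, 1 + z, 0, 1}) : t = z ∨ t = z + 1 / 2 := by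
  have key : ∀ x ∈ S, x ≠ 0 → x ≠ 1 → x ≠ t → x ≠ 1 + t →
      2 * x ≠ 1 + t ∧ (1 + t - x = 1 / 2 ∨ 1 + t - x = 1 / 2 + z ∨ 1 + t - x = 1 + z) := by
    intro x hx h0 h1 h2 h3
    have a := h x hx h0 h1 h2 h3
    have b := hS' a.1
    simp only [Set.mem_insert_iff, Set.mem_singleton_iff] at b
    refine ⟨?_, by grind⟩
    intro hx2
    rcases lt_or_gt_of_ne ht with ht | ht
    · have := h.bounds_of_neg ht hx h0 h1 h2 h3
      grind
    · have := h.bounds_of_pos ht hx h0 h1 h2 h3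
      grind
  have k1 := key (1 / 2) (hS (by simp)) (by norm_num) (by norm_num)
  have k2 := key (1 / 2 + z) (hS (by simp)) (by linarith) (by linarith)
  have k3 := key (1 + z) (hS (by simp)) (by linarith) (by linarith)
  grind

theorem IsPencilSet.eq_or_eq_of_neg {S : Set ℝ} {t z : ℝ} (ht : t ≠ 0) (hz : z < -(1 / 2))
    (h : IsPencilSet S t) (hS : {1 / 2, z, 1 / 2 + z} ⊆ S)
    (hS' : S ⊆ {1 / 2, z, 1 / 2 + z, 0, 1}) : t = z ∨ t = z - 1 / 2 := by
  have := IsPencilSet.eq_or_eq_of_pos (t := -t) (z := -z) (by simpa using ht) (by linarith)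
    (h.one_sub ht)
    (by
      rintro x (rfl | rfl | rfl)
      · exact hS (by norm_num)
      · exact hS (by simp only [Set.mem_insert_iff, Set.mem_singleton_iff]; right; right; ring)
      · exact hS (by simp))
    (by
      intro x hx
      have := @hS' (1 - x) hx
      simp only [Set.mem_insert_iff, Set.mem_singleton_iff] at this ⊢
      grind)
  grind

/-! ### Hilbert dimension and mirror eigenspaces -/

theorem hilbertDim_congr {K L : Type u} [NormedAddCommGroup K] [InnerProductSpace ℂ K]
    [NormedAddCommGroup L] [InnerProductSpace ℂ L] (e : K ≃ₗᵢ[ℂ] L) :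
    hilbertDim K = hilbertDim L := by
  unfold hilbertDim
  congr 1
  ext c
  constructor
  · rintro ⟨ι, ⟨b⟩, h⟩
    exact ⟨ι, ⟨.ofRepr (e.symm.trans b.repr)⟩, h⟩
  · rintro ⟨ι, ⟨b⟩, h⟩
    exact ⟨ι, ⟨.ofRepr (e.trans b.repr)⟩, h⟩

theorem exists_hilbertBasis_mk_eq_hilbertDim (K : Type u) [NormedAddCommGroup K]
    [InnerProductSpace ℂ K] [CompleteSpace K] :
    ∃ ι : Type u, Nonempty (HilbertBasis ι ℂ K) ∧ #ι = hilbertDim K := by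
  obtain ⟨w, b, -⟩ := exists_hilbertBasis ℂ K
  exact csInf_mem (s := {c | ∃ ι : Type u, Nonempty (HilbertBasis ι ℂ K) ∧ #ι = c})
    ⟨_, w, ⟨b⟩, rfl⟩

theorem nonempty_linearIsometryEquiv_of_hilbertDim_eq {K L : Type u} [NormedAddCommGroup K]
    [InnerProductSpace ℂ K] [CompleteSpace K] [NormedAddCommGroup L] [InnerProductSpace ℂ L]
    [CompleteSpace L] (h : hilbertDim K = hilbertDim L) : Nonempty (K ≃ₗᵢ[ℂ] L) := by
  obtain ⟨ι, ⟨b⟩, hb⟩ := exists_hilbertBasis_mk_eq_hilbertDim K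
  obtain ⟨κ, ⟨d⟩, hd⟩ := exists_hilbertBasis_mk_eq_hilbertDim L
  obtain ⟨e⟩ := Cardinal.eq.1 (hb.trans (h.trans hd.symm))
  have hr : Set.range (d ∘ e) = Set.range d := e.surjective.range_comp d
  let d' : HilbertBasis ι ℂ L := HilbertBasis.mk (d.orthonormal.comp e e.injective)
    (by rw [hr]; exact d.dense_span.ge)
  exact ⟨b.repr.trans d'.repr.symm⟩

section
variable {H : Type u} [NormedAddCommGroup H] [InnerProductSpace ℂ H]

theorem mem_ker_sub_smul_id {T : H →L[ℂ] H} {x : ℝ} {v : H} :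
    v ∈ (T - (x : ℂ) • ContinuousLinearMap.id ℂ H).ker ↔ T v = (x : ℂ) • v := by
  simp [sub_eq_zero]

variable [CompleteSpace H]

theorem nullDim_eq_of_partialIsometry {T G : H →L[ℂ] H} {x y : ℝ}
    (h1 : ∀ v, T v = (x : ℂ) • v → T (G v) = (y : ℂ) • G v)
    (h2 : ∀ v, T v = (y : ℂ) • v → T (star G v) = (x : ℂ) • star G v)
    (h3 : ∀ v, T v = (x : ℂ) • v → star G (G v) = v)
    (h4 : ∀ v, T v = (y : ℂ) • v → G (star G v) = v) : nullDim T x = nullDim T y := by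
  set K := (T - (x : ℂ) • ContinuousLinearMap.id ℂ H).ker with hK
  set L := (T - (y : ℂ) • ContinuousLinearMap.id ℂ H).ker with hL
  let f : K →ₗ[ℂ] L := (G : H →ₗ[ℂ] H).restrict
    fun v hv => mem_ker_sub_smul_id.2 (h1 v (mem_ker_sub_smul_id.1 hv))
  let g : L →ₗ[ℂ] K := ((star G : H →L[ℂ] H) : H →ₗ[ℂ] H).restrict
    fun v hv => mem_ker_sub_smul_id.2 (h2 v (mem_ker_sub_smul_id.1 hv))
  let e : K ≃ₗ[ℂ] L := LinearEquiv.ofLinearMap f g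
    (by ext v; exact h4 v (mem_ker_sub_smul_id.1 v.2))
    (by ext v; exact h3 v (mem_ker_sub_smul_id.1 v.2))
  refine hilbertDim_congr (K := K) (L := L) ⟨e, fun v => ?_⟩
  change ‖G v‖ = ‖(v : H)‖
  have h : ‖G v‖ ^ 2 = ‖(v : H)‖ ^ 2 := by
    rw [← inner_self_eq_norm_sq (𝕜 := ℂ), ← inner_self_eq_norm_sq (𝕜 := ℂ),
      ← ContinuousLinearMap.adjoint_inner_right, ← ContinuousLinearMap.star_eq_adjoint,
      h3 v (mem_ker_sub_smul_id.1 v.2)]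
  exact (sq_eq_sq₀ (norm_nonneg _) (norm_nonneg _)).1 h

/-- `W` is skew-adjoint, swaps the two eigenspaces, and satisfies `t² W² = -c` on both, where `c >
0` is the common value of the quartic. Hence `(t/√c) W` is unitary between them. -/
theorem nullDim_pencil_eq {P Q : H →L[ℂ] H} (hP : IsStarProjection P) (hQ : IsStarProjection Q)
    {t x y : ℝ} (hy : y = 1 + t - x) (ht : t ≠ 0) (hp : 0 < x * y * ((x - 1) * (x - t))) :
    nullDim ((t : ℂ) • P + Q) x = nullDim ((t : ℂ) • P + Q) y := by
  have a1 := IsIdempotentElem.commutator_mul_pencil hP.isIdempotentElem hQ.isIdempotentElem (t : ℂ)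
  have a2 := IsIdempotentElem.commutator_mul_pencil hQ.isIdempotentElem hP.isIdempotentElem
    (t : ℂ)⁻¹
  have a3 := IsIdempotentElem.smul_commutator_mul_commutator hP.isIdempotentElem
    hQ.isIdempotentElem (t : ℂ)
  have hstar : star (P * Q - Q * P) = -(P * Q - Q * P) := by
    rw [star_sub, star_mul, star_mul, hP.isSelfAdjoint.star_eq, hQ.isSelfAdjoint.star_eq, neg_sub]
  rw [← neg_sub (P * Q) (Q * P)] at a3
  generalize (t : ℂ) • P + Q = T at *
  generalize P * Q - Q * P = W at *
  set c := x * y * ((x - 1) * (x - t)) with hc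
  have ht' : (t : ℂ) ≠ 0 := by exact_mod_cast ht
  have hs : (Real.sqrt c : ℂ) ^ 2 = c := by exact_mod_cast Real.sq_sqrt hp.le
  have hc' : (c : ℂ) ≠ 0 := by exact_mod_cast hp.ne'
  have swap : ∀ z : ℝ, ∀ v, T v = (z : ℂ) • v → T (W v) = ((1 + t - z : ℝ) : ℂ) • W v := by
    intro z v hv
    have := congrArg (fun A : H →L[ℂ] H => A v) a1
    simp only [mul_apply_eq_comp, sub_apply,
      smul_apply, one_apply_eq_self, hv, map_smul] at this
    have h2 : T (W v) = (1 + (t : ℂ)) • W v - (z : ℂ) • W v := by rw [this]; abel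
    rw [h2]; push_cast; module
  have sq : ∀ z : ℝ, z * (1 + t - z) * ((z - 1) * (z - t)) = c → ∀ v, T v = (z : ℂ) • v →
      (t : ℂ) ^ 2 • W (W v) = -((c : ℂ) • v) := by
    intro z hz v hv
    have := congrArg (fun A : H →L[ℂ] H => A v) a3
    simp only [mul_apply_eq_comp, sub_apply,
      smul_apply, one_apply_eq_self, hv, map_smul, map_sub,
      neg_apply] at this
    rw [← hz]
    rw [smul_neg, neg_eq_iff_eq_neg] at this
    rw [this]
    push_cast
    module
  have hG : star (((t / Real.sqrt c : ℝ) : ℂ) • W) = -(((t / Real.sqrt c : ℝ) : ℂ) • W) := by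
    rw [star_smul, hstar, smul_neg]; simp
  have hr : ((t / Real.sqrt c : ℝ) : ℂ) * ((t / Real.sqrt c : ℝ) : ℂ) = (c : ℂ)⁻¹ * (t : ℂ) ^ 2 := by
    rw [← hs]; push_cast; field_simp
  have inv : ∀ z : ℝ, z * (1 + t - z) * ((z - 1) * (z - t)) = c → ∀ v, T v = (z : ℂ) • v →
      ((t / Real.sqrt c : ℝ) : ℂ) • W (((t / Real.sqrt c : ℝ) : ℂ) • W v) = -v := by
    intro z hz v hv
    rw [map_smul, smul_smul, hr, ← smul_smul, sq z hz v hv, smul_neg, smul_smul,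
      inv_mul_cancel₀ hc', one_smul]
  have swap' : ∀ z w : ℝ, w = 1 + t - z → ∀ v, T v = (z : ℂ) • v →
      T (((t / Real.sqrt c : ℝ) : ℂ) • W v) = (w : ℂ) • ((t / Real.sqrt c : ℝ) : ℂ) • W v := by
    intro z w h v hv
    rw [map_smul, swap z v hv, smul_comm, h]
  have hx : x * (1 + t - x) * ((x - 1) * (x - t)) = c := by rw [hc, hy]
  have hy' : y * (1 + t - y) * ((y - 1) * (y - t)) = c := by rw [hc, hy]; ring
  refine nullDim_eq_of_partialIsometry (G := ((t / Real.sqrt c : ℝ) : ℂ) • W) ?_ ?_ ?_ ?_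
  · exact swap' x y hy
  · intro v hv
    rw [hG, neg_apply, map_neg, smul_neg]
    exact congrArg _ (swap' y x (by linarith) v hv)
  · intro v hv
    rw [hG, neg_apply]
    exact neg_eq_iff_eq_neg.2 (inv x hx v hv)
  · intro v hv
    rw [hG, neg_apply, map_neg]
    exact neg_eq_iff_eq_neg.2 (inv y hy' v hv)
end

/-! ### Spectral projections for a finite spectrum -/

section
variable {A : Type*} [CStarAlgebra A]

/-- The spectral projection of `T` at an isolated point `s` of its spectrum. -/
noncomputable def spectralProj (T : A) (s : ℂ) : A :=
  open Classical in cfc (fun y : ℂ => if y = s then (1 : ℂ) else 0) T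

/-- Every function is continuous on a finite set, so identities between indicator functions pass
through `cfc`. -/
theorem isStarProjection_spectralProj (T : A) (hfin : (spectrum ℂ T).Finite) (s : ℂ) :
    IsStarProjection (spectralProj T s) := by
  classical
  refine ⟨?_, ?_⟩
  · unfold IsIdempotentElem spectralProj
    rw [← cfc_mul _ _ _ (hfin.continuousOn _) (hfin.continuousOn _)]
    congr 1; ext y; split_ifs <;> simp
  · unfold IsSelfAdjoint spectralProj
    rw [← cfc_star]
    congr 1; ext y; split_ifs <;> simp

theorem spectralProj_mul_of_ne (T : A) (hfin : (spectrum ℂ T).Finite) {s r : ℂ} (h : s ≠ r) :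
    spectralProj T s * spectralProj T r = 0 := by
  classical
  unfold spectralProj
  rw [← cfc_mul _ _ _ (hfin.continuousOn _) (hfin.continuousOn _), ← cfc_zero ℂ T]
  congr 1; ext y
  by_cases h1 : y = s
  · subst h1; simp [h]
  · simp [h1]

theorem mul_spectralProj (T : A) [IsStarNormal T] (hfin : (spectrum ℂ T).Finite) (s : ℂ) :
    T * spectralProj T s = s • spectralProj T s := by
  classical
  unfold spectralProj
  nth_rewrite 1 [← cfc_id' ℂ T]
  rw [← cfc_mul _ _ _ (hfin.continuousOn _) (hfin.continuousOn _),
    ← cfc_smul _ _ _ (hfin.continuousOn _)]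
  congr 1; ext y; split_ifs with h <;> simp [h]

theorem spectralProj_mul (T : A) [IsStarNormal T] (hfin : (spectrum ℂ T).Finite) (s : ℂ) :
    spectralProj T s * T = s • spectralProj T s := by
  classical
  unfold spectralProj
  nth_rewrite 2 [← cfc_id' ℂ T]
  rw [← cfc_mul _ _ _ (hfin.continuousOn _) (hfin.continuousOn _),
    ← cfc_smul _ _ _ (hfin.continuousOn _)]
  congr 1; ext y; split_ifs with h <;> simp [h]

theorem sum_spectralProj (T : A) [IsStarNormal T] (F : Finset ℂ) (hF : spectrum ℂ T ⊆ F) :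
    ∑ s ∈ F, spectralProj T s = 1 := by
  classical
  have hfin : (spectrum ℂ T).Finite := F.finite_toSet.subset hF
  unfold spectralProj
  rw [← cfc_sum _ _ _ fun _ _ => hfin.continuousOn _, ← cfc_one ℂ T]
  refine cfc_congr fun y hy => ?_
  simp [Finset.sum_apply, Finset.mem_coe.1 (hF hy)]

theorem spectralProj_ne_zero (T : A) [IsStarNormal T] (hfin : (spectrum ℂ T).Finite) {s : ℂ}
    (hs : s ∈ spectrum ℂ T) : spectralProj T s ≠ 0 := by
  classical
  intro h
  have h1 : (1 : ℂ) ∈ spectrum ℂ (spectralProj T s) := by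
    unfold spectralProj
    rw [cfc_map_spectrum _ T (hf := hfin.continuousOn _)]
    exact ⟨s, hs, by simp⟩
  rw [h] at h1
  rcases subsingleton_or_nontrivial A with hA | hA
  · simp [spectrum.of_subsingleton] at h1
  · simp at h1

end

/-! ### Building the two projections -/

section
variable {A : Type*} [Ring A] [StarRing A] [Algebra ℂ A] [StarModule ℂ A]

/-- Identifying `Ea` with `Eb` through `V`, the first three terms form the block `[[α, γ], [γ, β]]`,
of trace `1` and determinant `0`, hence a projection; `δ` and `ε` are each `0` or `1`. -/
theorem isStarProjection_of_partialIsometry {Ea Eb Ec Ed V : A} (ha : IsStarProjection Ea)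
    (hc : IsStarProjection Ec) (hd : IsStarProjection Ed)
    (hab : Ea * Eb = 0) (hca : Ec * Ea = 0) (hcb : Ec * Eb = 0)
    (hda : Ed * Ea = 0) (hdb : Ed * Eb = 0) (hcd : Ec * Ed = 0)
    (hV : star V * V = Ea) (hV' : V * star V = Eb) (hVa : V * Ea = V) {α β γ δ ε : ℝ}
    (h1 : α + β = 1) (h2 : α * β = γ ^ 2) (h3 : δ ^ 2 = δ) (h4 : ε ^ 2 = ε) :
    IsStarProjection ((α : ℂ) • Ea + (β : ℂ) • Eb + (γ : ℂ) • (V + star V) + (δ : ℂ) • Ec +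
      (ε : ℂ) • Ed) := by
  have hbs : star Eb = Eb := by rw [← hV', star_mul, star_star]
  have has := ha.isSelfAdjoint.star_eq
  have hcs := hc.isSelfAdjoint.star_eq
  have hds := hd.isSelfAdjoint.star_eq
  have m1 : Eb * V = V := by rw [← hV', mul_assoc, hV, hVa]
  have m2 : Ea * star V = star V := by simpa [has] using congrArg star hVa
  have m3 : star V * Eb = star V := by simpa [hbs] using congrArg star m1
  have hba : Eb * Ea = 0 := by simpa [has, hbs] using congrArg star hab
  have hac : Ea * Ec = 0 := by simpa [has, hcs] using congrArg star hca
  have hbc : Eb * Ec = 0 := by simpa [hbs, hcs] using congrArg star hcb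
  have had : Ea * Ed = 0 := by simpa [has, hds] using congrArg star hda
  have hbd : Eb * Ed = 0 := by simpa [hbs, hds] using congrArg star hdb
  have hdc : Ed * Ec = 0 := by simpa [hcs, hds] using congrArg star hcd
  have haV : Ea * V = 0 := by rw [← m1, ← mul_assoc, hab, zero_mul]
  have hcV : Ec * V = 0 := by rw [← m1, ← mul_assoc, hcb, zero_mul]
  have hdV : Ed * V = 0 := by rw [← m1, ← mul_assoc, hdb, zero_mul]
  have hbS : Eb * star V = 0 := by rw [← m2, ← mul_assoc, hba, zero_mul]
  have hcS : Ec * star V = 0 := by rw [← m2, ← mul_assoc, hca, zero_mul]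
  have hdS : Ed * star V = 0 := by rw [← m2, ← mul_assoc, hda, zero_mul]
  have hVb : V * Eb = 0 := by rw [← hVa, mul_assoc, hab, mul_zero]
  have hVc : V * Ec = 0 := by rw [← hVa, mul_assoc, hac, mul_zero]
  have hVd : V * Ed = 0 := by rw [← hVa, mul_assoc, had, mul_zero]
  have hSa : star V * Ea = 0 := by rw [← m3, mul_assoc, hba, mul_zero]
  have hSc : star V * Ec = 0 := by rw [← m3, mul_assoc, hbc, mul_zero]
  have hSd : star V * Ed = 0 := by rw [← m3, mul_assoc, hbd, mul_zero]
  have hVV : V * V = 0 := by nth_rewrite 2 [← m1]; rw [← mul_assoc, hVb, zero_mul]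
  have hSS : star V * star V = 0 := by nth_rewrite 2 [← m2]; rw [← mul_assoc, hSa, zero_mul]
  have haa : Ea * Ea = Ea := ha.isIdempotentElem
  have hbb : Eb * Eb = Eb := by nth_rewrite 2 [← hV']; rw [← mul_assoc, m1, hV']
  have hcc : Ec * Ec = Ec := hc.isIdempotentElem
  have hdd : Ed * Ed = Ed := hd.isIdempotentElem
  refine ⟨?_, ?_⟩
  · unfold IsIdempotentElem
    simp only [mul_add, add_mul, smul_mul_assoc, mul_smul_comm, smul_add, *, smul_zero, add_zero,
      zero_add]
    have k1 : (α : ℂ) + β = 1 := by exact_mod_cast h1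
    have k2 : (α : ℂ) * β = γ ^ 2 := by exact_mod_cast h2
    have k3 : (δ : ℂ) ^ 2 = δ := by exact_mod_cast h3
    have k4 : (ε : ℂ) ^ 2 = ε := by exact_mod_cast h4
    have j1 : (α : ℂ) * α + γ * γ = α := by linear_combination α * k1 - k2
    have j2 : (β : ℂ) * β + γ * γ = β := by linear_combination β * k1 - k2
    linear_combination (norm := module) j1 • Ea + j2 • Eb + k3 • Ec + k4 • Ed +
      (congrArg (fun w => (γ : ℂ) * w) k1) • (V + star V)
  · unfold IsSelfAdjoint
    simp only [star_add, star_smul, has, hbs, hcs, hds, star_star, RCLike.star_def,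
      Complex.conj_ofReal]
    rw [add_comm (star V)]

end

/-- Reads off the corner coefficient `α`, which certifies that the constructed projections are
nonzero. -/
theorem mul_partialIsometry_mul {A : Type*} [Ring A] [StarRing A] [Algebra ℂ A]
    {Ea Eb Ec Ed V : A} (ha : Ea * Ea = Ea)
    (hab : Ea * Eb = 0) (hac : Ea * Ec = 0) (had : Ea * Ed = 0) (hba : Eb * Ea = 0)
    (hVb : Eb * V = V) (hVs : star V * Eb = star V) (α β γ δ ε : ℂ) :
    Ea * (α • Ea + β • Eb + γ • (V + star V) + δ • Ec + ε • Ed) * Ea = α • Ea := by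
  have haV : Ea * V = 0 := by rw [← hVb, ← mul_assoc, hab, zero_mul]
  have hSa : star V * Ea = 0 := by rw [← hVs, mul_assoc, hba, mul_zero]
  simp [mul_add, add_mul, mul_assoc, ha, hab, hac, had, hSa, haV]

section
variable {H : Type u} [NormedAddCommGroup H] [InnerProductSpace ℂ H] [CompleteSpace H]

theorem spectralProj_apply_of_apply_eq {T : H →L[ℂ] H} (hT : IsSelfAdjoint T)
    (hfin : (spectrum ℂ T).Finite) {s : ℂ} {v : H} (hv : T v = s • v) :
    spectralProj T s v = v := by
  classical
  have hn := hT.isStarNormal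
  have hsum := congrArg (fun B : H →L[ℂ] H => B v)
    (sum_spectralProj T (insert s hfin.toFinset) (by intro x hx; simp [hx]))
  simp only [sum_apply, one_apply_eq_self] at hsum
  rw [Finset.sum_eq_single s] at hsum
  · exact hsum
  · intro r _ hr
    have h := congrArg (fun B : H →L[ℂ] H => B v) (spectralProj_mul T hfin r)
    simp only [mul_apply_eq_comp, hv, map_smul, smul_apply] at h
    rw [← sub_eq_zero, ← sub_smul] at h
    exact (smul_eq_zero.1 h).resolve_left (sub_ne_zero.2 hr.symm)
  · intro h; simp at h

/-- Equal dimensions give a unitary between the two null spaces; `V` extends it by zero on the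
orthogonal complement. -/
theorem exists_partialIsometry_spectralProj {T : H →L[ℂ] H} (hT : IsSelfAdjoint T)
    (hfin : (spectrum ℂ T).Finite) {x y : ℝ} (h : nullDim T x = nullDim T y) :
    ∃ V : H →L[ℂ] H, star V * V = spectralProj T x ∧ V * star V = spectralProj T y ∧
      V * spectralProj T x = V := by
  have hn := hT.isStarNormal
  set K := (T - (x : ℂ) • ContinuousLinearMap.id ℂ H).ker with hK
  set L := (T - (y : ℂ) • ContinuousLinearMap.id ℂ H).ker with hL
  have : CompleteSpace K :=
    (T - (x : ℂ) • ContinuousLinearMap.id ℂ H).isClosed_ker.completeSpace_coe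
  have : CompleteSpace L :=
    (T - (y : ℂ) • ContinuousLinearMap.id ℂ H).isClosed_ker.completeSpace_coe
  obtain ⟨U⟩ := nonempty_linearIsometryEquiv_of_hilbertDim_eq (K := K) (L := L) h
  have hmem (s : ℝ) (v : H) :
      spectralProj T s v ∈ (T - (s : ℂ) • ContinuousLinearMap.id ℂ H).ker :=
    mem_ker_sub_smul_id.2 (congrArg (fun B : H →L[ℂ] H => B v) (mul_spectralProj T hfin s))
  have hfix (s : ℝ) (v : H) (hv : v ∈ (T - (s : ℂ) • ContinuousLinearMap.id ℂ H).ker) :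
      spectralProj T s v = v :=
    spectralProj_apply_of_apply_eq hT hfin (mem_ker_sub_smul_id.1 hv)
  have hsymm (s : ℝ) (v w : H) :
      inner ℂ (spectralProj T s v) w = inner ℂ v (spectralProj T s w) := by
    rw [← ContinuousLinearMap.adjoint_inner_left, ← ContinuousLinearMap.star_eq_adjoint,
      (isStarProjection_spectralProj T hfin s).isSelfAdjoint.star_eq]
  let V : H →L[ℂ] H := L.subtypeL ∘L (U : K →L[ℂ] L) ∘L
    (spectralProj T x).codRestrict K (hmem x)
  let V' : H →L[ℂ] H := K.subtypeL ∘L (U.symm : L →L[ℂ] K) ∘L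
    (spectralProj T y).codRestrict L (hmem y)
  have hVa (v : H) : V v = U ⟨spectralProj T x v, hmem x v⟩ := rfl
  have hVa' (v : H) : V' v = U.symm ⟨spectralProj T y v, hmem y v⟩ := rfl
  have hstar : star V = V' := by
    rw [ContinuousLinearMap.star_eq_adjoint, eq_comm, ContinuousLinearMap.eq_adjoint_iff]
    intro v w
    have e1 : inner ℂ (V' v) w = inner ℂ (V' v) (spectralProj T x w) := by
      rw [← hsymm, hfix x (V' v) (by rw [hVa']; exact Subtype.property _)]
    have e2 : inner ℂ v (V w) = inner ℂ (spectralProj T y v) (V w) := by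
      rw [hsymm, hfix y (V w) (by rw [hVa]; exact Subtype.property _)]
    rw [e1, e2, hVa, hVa']
    have := U.symm.inner_map_map ⟨spectralProj T y v, hmem y v⟩
      (U ⟨spectralProj T x w, hmem x w⟩)
    rw [U.symm_apply_apply] at this
    exact this
  refine ⟨V, ?_, ?_, ?_⟩
  · ext v
    rw [hstar, mul_apply_eq_comp, hVa']
    have : (⟨spectralProj T y (V v), hmem y (V v)⟩ : L) = U ⟨spectralProj T x v, hmem x v⟩ :=
      Subtype.ext (hfix y _ (by rw [hVa]; exact Subtype.property _))
    rw [this, U.symm_apply_apply]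
  · ext v
    rw [hstar, mul_apply_eq_comp, hVa]
    have : (⟨spectralProj T x (V' v), hmem x (V' v)⟩ : K) =
        U.symm ⟨spectralProj T y v, hmem y v⟩ :=
      Subtype.ext (hfix x _ (by rw [hVa']; exact Subtype.property _))
    rw [this, U.apply_symm_apply]
  · ext v
    rw [mul_apply_eq_comp, hVa, hVa]
    congr 3
    exact hfix x _ (hmem x v)

/-- The eigenvalues `1/2` and `1/2 + t` are paired by the reflection and share a `2 × 2` block. The
others are handled diagonally: at `c`, `P = 1` and `Q = δ`; at `1`, `P = 0` and `Q = 1`; at `0`,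
both vanish. -/
theorem isPencilAt_of_spectrum_subset {T : H →L[ℂ] H} (hT : IsSelfAdjoint T) {t c δ : ℝ}
    (ht : 1 / 4 < t ^ 2) (hc : c = t + δ) (hδ : δ ^ 2 = δ) (hc0 : c ≠ 0) (hc1 : c ≠ 1)
    (hc2 : c ≠ 1 / 2) (h1 : (1 / 2 : ℂ) ∈ spectrum ℂ T)
    (h2 : spectrum ℂ T ⊆ {1 / 2, 1 / 2 + (t : ℂ), (c : ℂ), 0, 1})
    (hdim : nullDim T (1 / 2) = nullDim T (1 / 2 + t)) : IsPencilAt T t := by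
  classical
  have hn := hT.isStarNormal
  have ht0 : t ≠ 0 := by rintro rfl; norm_num at ht
  have ht1 : t ≠ 1 / 2 := by rintro rfl; norm_num at ht
  have ht2 : t ≠ -(1 / 2) := by rintro rfl; norm_num at ht
  have hcb : c ≠ 1 / 2 + t := by
    intro h
    have : δ = 1 / 2 := by linarith
    rw [this] at hδ; norm_num at hδ
  have hfin : (spectrum ℂ T).Finite := Set.Finite.subset (by simp) h2
  obtain ⟨V, hV1, hV2, hV3⟩ := exists_partialIsometry_spectralProj hT hfin hdim
  set E : ℝ → (H →L[ℂ] H) := fun s => spectralProj T s with hE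
  have hproj (s : ℝ) : IsStarProjection (E s) := isStarProjection_spectralProj T hfin s
  have horth {s r : ℝ} (h : s ≠ r) : E s * E r = 0 :=
    spectralProj_mul_of_ne T hfin (by exact_mod_cast h)
  change star V * V = E (1 / 2) at hV1
  change V * star V = E (1 / 2 + t) at hV2
  change V * E (1 / 2) = V at hV3
  have hsum : E (1 / 2) + E (1 / 2 + t) + E c + E 0 + E 1 = 1 := by
    have hF := sum_spectralProj T {((1 / 2 : ℝ) : ℂ), ((1 / 2 + t : ℝ) : ℂ), (c : ℂ),
      ((0 : ℝ) : ℂ), ((1 : ℝ) : ℂ)} (by simpa using h2)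
    rw [Finset.sum_insert, Finset.sum_insert, Finset.sum_insert, Finset.sum_insert,
      Finset.sum_singleton] at hF
    · rw [← hF]; abel
    all_goals
      simp only [Finset.mem_insert, Finset.mem_singleton, Complex.ofReal_inj]
      grind
  have hTE (s : ℝ) : T * E s = (s : ℂ) • E s := mul_spectralProj T hfin s
  have hTsum : T = ((1 / 2 : ℝ) : ℂ) • E (1 / 2) + ((1 / 2 + t : ℝ) : ℂ) • E (1 / 2 + t) +
      (c : ℂ) • E c + E 1 := by
    have h := congrArg (T * ·) hsum
    simp only [mul_add, hTE, mul_one] at h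
    rw [← h]; simp
  have hEa : E (1 / 2) ≠ 0 := spectralProj_ne_zero T hfin (by simpa using h1)
  have hab : (1 / 2 : ℝ) ≠ 1 / 2 + t := by intro h; exact ht0 (by linarith)
  have hb1 : (1 : ℝ) ≠ 1 / 2 + t := by intro h; exact ht1 (by linarith)
  set γ := Real.sqrt (1 / (4 * t ^ 2) * (1 - 1 / (4 * t ^ 2))) with hγ
  have hγ2 : γ ^ 2 = 1 / (4 * t ^ 2) * (1 - 1 / (4 * t ^ 2)) := by
    refine Real.sq_sqrt (mul_nonneg (by positivity) ?_)
    rw [sub_nonneg, div_le_one (by positivity)]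
    linarith
  have mk {α β γ δ ε : ℝ} := isStarProjection_of_partialIsometry (V := V) (hproj (1 / 2))
    (hproj c) (hproj 1) (horth hab) (horth hc2) (horth hcb) (horth (by norm_num)) (horth hb1)
    (horth hc1) hV1 hV2 hV3 (α := α) (β := β) (γ := γ) (δ := δ) (ε := ε)
  have hVb : E (1 / 2 + t) * V = V := by rw [← hV2, mul_assoc, hV1, hV3]
  have hVs : star V * E (1 / 2 + t) = star V := by
    have h := congrArg star hVb
    rwa [star_mul, (hproj (1 / 2 + t)).isSelfAdjoint.star_eq] at h
  have cut (α β γ δ ε : ℂ) := mul_partialIsometry_mul (V := V) (hproj (1 / 2)).isIdempotentElem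
    (horth hab) (horth hc2.symm) (horth (r := 1) (by norm_num)) (horth hab.symm) hVb hVs α β γ δ ε
  have hne (α β γ δ ε : ℝ) (hα : α ≠ 0) : (α : ℂ) • E (1 / 2) + (β : ℂ) • E (1 / 2 + t) +
      (γ : ℂ) • (V + star V) + (δ : ℂ) • E c + (ε : ℂ) • E 1 ≠ 0 := by
    intro h
    have h' := cut α β γ δ ε
    rw [h, mul_zero, zero_mul] at h'
    exact smul_ne_zero (by exact_mod_cast hα) hEa h'.symm
  -- If `P` has corner `α`, then `Q` has diagonal `1/2 - tα`, `1/2 + tα` and off-diagonal entry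
  -- `-tγ`. Zero determinant for both blocks forces `α = 1/(4t²)`, and `1/4 < t²` keeps `γ` real.
  refine ⟨_, _, mk (α := 1 / (4 * t ^ 2)) (β := 1 - 1 / (4 * t ^ 2)) (γ := γ) (δ := 1) (ε := 0)
      (by ring) hγ2.symm (by norm_num) (by norm_num),
    mk (α := 1 / 2 - 1 / (4 * t)) (β := 1 / 2 + 1 / (4 * t)) (γ := -t * γ) (δ := δ) (ε := 1)
      (by ring) ?_ hδ (by norm_num), hne _ _ _ _ _ ?_, hne _ _ _ _ _ ?_, ?_⟩
  · rw [mul_pow, hγ2]; field_simp; ring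
  · positivity
  · intro h
    apply ht1
    field_simp at h
    linarith
  · have e1 : (t : ℂ) * ((1 / (4 * t ^ 2) : ℝ) : ℂ) = ((1 / (4 * t) : ℝ) : ℂ) := by
      rw [← Complex.ofReal_mul]; congr 1; field_simp
    have e2 : (c : ℂ) = t + δ := by exact_mod_cast hc
    conv_lhs => rw [hTsum]
    simp only [smul_add, smul_smul, Complex.ofReal_sub, Complex.ofReal_add, mul_sub, e1, e2,
      Complex.ofReal_mul, Complex.ofReal_neg, Complex.ofReal_one, Complex.ofReal_zero]
    module
end

/-! ### From pencils to spectral conditions and back -/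

section
variable {H : Type u} [NormedAddCommGroup H] [InnerProductSpace ℂ H] [CompleteSpace H]

/-- The spectrum of a self-adjoint operator, as a set of reals. -/
def realSpectrum {H : Type u} [NormedAddCommGroup H] [InnerProductSpace ℂ H]
    (T : H →L[ℂ] H) : Set ℝ := {x | (x : ℂ) ∈ spectrum ℂ T}

theorem spectrum_subset_image_iff {T : H →L[ℂ] H} (hT : IsSelfAdjoint T) {S : Set ℝ} :
    spectrum ℂ T ⊆ (fun x : ℝ => (x : ℂ)) '' S ↔ realSpectrum T ⊆ S := by
  constructor
  · intro h x hx
    obtain ⟨y, hy, hxy⟩ := h hx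
    rwa [← Complex.ofReal_injective hxy]
  · intro h w hw
    obtain ⟨x, rfl⟩ := exists_real_of_mem_spectrum hT hw
    exact ⟨x, h hw, rfl⟩

theorem image_subset_spectrum_iff {H : Type u} [NormedAddCommGroup H] [InnerProductSpace ℂ H]
    {T : H →L[ℂ] H} {S : Set ℝ} :
    (fun x : ℝ => (x : ℂ)) '' S ⊆ spectrum ℂ T ↔ S ⊆ realSpectrum T :=
  Set.image_subset_iff

theorem IsPencilAt.isPencilSet {T : H →L[ℂ] H} {t : ℝ} (ht : t ≠ 0) (h : IsPencilAt T t) :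
    IsPencilSet (realSpectrum T) t := by
  obtain ⟨P, Q, hP, hQ, -, -, rfl⟩ := h
  exact isPencilSet_spectrum hP hQ ht

theorem IsPencilAt.nullDim_eq {T : H →L[ℂ] H} {t x y : ℝ} (h : IsPencilAt T t)
    (hy : y = 1 + t - x) (ht : t ≠ 0) (hp : 0 < x * y * ((x - 1) * (x - t))) :
    nullDim T x = nullDim T y := by
  obtain ⟨P, Q, hP, hQ, -, -, rfl⟩ := h
  exact nullDim_pencil_eq hP hQ hy ht hp

theorem IsPencilAt.nullDim_half_eq {T : H →L[ℂ] H} {t y : ℝ} (h : IsPencilAt T t)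
    (ht : 1 / 4 < t ^ 2) (hy : y = 1 / 2 + t) : nullDim T (1 / 2) = nullDim T y := by
  refine h.nullDim_eq (by rw [hy]; ring) (by rintro rfl; norm_num at ht) ?_
  -- The quartic at `1/2` equals `(t² - 1/4)/4`.
  rw [hy]; nlinarith

theorem IsPencilAt.not_realSpectrum_subset {T : H →L[ℂ] H} (hT : IsSelfAdjoint T) {t : ℝ}
    (h : IsPencilAt T t) (h0 : t ≠ 0) (h1 : t ≠ 1) (h2 : t ≠ -1) :
    ¬ realSpectrum T ⊆ {0, 1} := by
  intro hS
  rw [← spectrum_subset_image_iff hT, Set.image_pair] at hS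
  have hi := isIdempotentElem_of_spectrum_subset hT (by simpa using hS)
  obtain ⟨P, Q, hP, hQ, hP0, -, rfl⟩ := h
  exact hP0 (left_eq_zero_of_isIdempotentElem_pencil hP hQ h0 h1 h2 hi)

theorem IsPencilAt.realSpectrum_subset_of_zero {T : H →L[ℂ] H} (h : IsPencilAt T 0) :
    realSpectrum T ⊆ {0, 1} := by
  obtain ⟨P, Q, hP, hQ, -, -, rfl⟩ := h
  intro x hx
  have hQs := hQ.isIdempotentElem.spectrum_subset ℂ
  have hx' : (x : ℂ) ∈ spectrum ℂ Q := by simpa [realSpectrum] using hx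
  simpa using hQs hx'

/-- The spectral condition for the parameters `z` and `z + 1 / 2`, with `z` positive. -/
def PosCondition (T : H →L[ℂ] H) (z : ℝ) : Prop :=
  1 / 2 < z ∧ {1 / 2, 1 / 2 + z, 1 + z} ⊆ realSpectrum T ∧
    realSpectrum T ⊆ {1 / 2, 1 / 2 + z, 1 + z, 0, 1} ∧
    nullDim T (1 / 2) = nullDim T (1 / 2 + z) ∧ nullDim T (1 / 2 + z) = nullDim T (1 + z)

/-- The spectral condition for the parameters `z` and `z - 1 / 2`, with `z` negative. -/
def NegCondition (T : H →L[ℂ] H) (z : ℝ) : Prop :=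
  z < -(1 / 2) ∧ {1 / 2, z, 1 / 2 + z} ⊆ realSpectrum T ∧
    realSpectrum T ⊆ {1 / 2, z, 1 / 2 + z, 0, 1} ∧
    nullDim T (1 / 2) = nullDim T (1 / 2 + z) ∧ nullDim T (1 / 2 + z) = nullDim T z

theorem posCondition_or_negCondition {T : H →L[ℂ] H} (hT : IsSelfAdjoint T) {l : ℝ}
    (hl : l ≠ 0) (hm : l + 1 / 2 ≠ 0) (hm1 : l + 1 / 2 ≠ 1) (hl1 : l ≠ -1)
    (h : IsPencilAt T l) (h' : IsPencilAt T (l + 1 / 2)) :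
    (∃ z, PosCondition T z) ∨ ∃ z, NegCondition T z := by
  have s := h.isPencilSet hl
  have s' := h'.isPencilSet hm
  rcases lt_or_gt_of_ne hl with hneg | hpos
  · rcases lt_or_gt_of_ne hm with hneg' | hpos'
    · right
      rcases IsPencilSet.subset_or_of_neg hneg' (by simpa using hl1) s'
        (by simpa using s) with a | ⟨a, b, c⟩
      · exact absurd a (h.not_realSpectrum_subset hT hl (by linarith) hl1)
      · have e1 := h'.nullDim_half_eq (by nlinarith) rfl
        have e2 := h.nullDim_half_eq (y := l + 1 / 2) (by nlinarith) (by ring)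
        exact ⟨l + 1 / 2, a, b, c, e1, e1.symm.trans e2⟩
    · exact absurd (IsPencilSet.subset_of_neg_of_pos hneg hpos' s s')
        (h.not_realSpectrum_subset hT hl (by linarith) hl1)
  · left
    rcases IsPencilSet.subset_or_of_pos hpos hm1 s s' with a | ⟨a, b, c⟩
    -- The larger parameter is used here, because `l` itself may be `1`.
    · exact absurd a (h'.not_realSpectrum_subset hT hm hm1 (by linarith))
    · have e1 := h.nullDim_half_eq (by nlinarith) rfl
      have e2 := h'.nullDim_half_eq (y := 1 + l) (by nlinarith) (by ring)
      exact ⟨l, a, b, c, e1, e1.symm.trans e2⟩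

theorem isPencilAt_of_realSpectrum_subset {T : H →L[ℂ] H} (hT : IsSelfAdjoint T) {t c δ : ℝ}
    (ht : 1 / 4 < t ^ 2) (hc : c = t + δ) (hδ : δ ^ 2 = δ) (hc0 : c ≠ 0) (hc1 : c ≠ 1)
    (hc2 : c ≠ 1 / 2) (h1 : 1 / 2 ∈ realSpectrum T)
    (h2 : realSpectrum T ⊆ {1 / 2, 1 / 2 + t, c, 0, 1})
    (hdim : nullDim T (1 / 2) = nullDim T (1 / 2 + t)) : IsPencilAt T t := by
  rw [← spectrum_subset_image_iff hT] at h2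
  refine isPencilAt_of_spectrum_subset hT ht hc hδ hc0 hc1 hc2 (by simpa [realSpectrum] using h1)
    ?_ hdim
  simpa [Set.image_insert_eq] using h2

/-- At parameter `z` the partner of `1/2` is `1/2 + z`, leaving `1 + z` (`δ = 1`). At `z + 1/2` the
partner is `1 + z`, leaving the parameter itself (`δ = 0`). -/
theorem PosCondition.isPencilAt {T : H →L[ℂ] H} (hT : IsSelfAdjoint T) {z : ℝ}
    (h : PosCondition T z) : IsPencilAt T z ∧ IsPencilAt T (z + 1 / 2) := by
  obtain ⟨hz, a, b, d, e⟩ := h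
  constructor
  · exact isPencilAt_of_realSpectrum_subset hT (c := 1 + z) (δ := 1) (by nlinarith) (by ring)
      (by norm_num) (by linarith) (by linarith) (by linarith) (a (by simp)) b d
  · have e0 : 1 / 2 + (z + 1 / 2) = 1 + z := by ring
    refine isPencilAt_of_realSpectrum_subset hT (c := 1 / 2 + z) (δ := 0) (by nlinarith) (by ring)
      (by norm_num) (by linarith) (by linarith) (by linarith) (a (by simp)) ?_ ?_
    · rw [e0, Set.insert_comm (1 + z)]; exact b
    · rw [e0, d, e]

theorem NegCondition.isPencilAt {T : H →L[ℂ] H} (hT : IsSelfAdjoint T) {z : ℝ}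
    (h : NegCondition T z) : IsPencilAt T z ∧ IsPencilAt T (z - 1 / 2) := by
  obtain ⟨hz, a, b, d, e⟩ := h
  constructor
  · refine isPencilAt_of_realSpectrum_subset hT (c := z) (δ := 0) (by nlinarith) (by ring)
      (by norm_num) (by linarith) (by linarith) (by linarith) (a (by simp)) ?_ d
    rw [Set.insert_comm (1 / 2 + z)]; exact b
  · have e0 : 1 / 2 + (z - 1 / 2) = z := by ring
    refine isPencilAt_of_realSpectrum_subset hT (c := 1 / 2 + z) (δ := 1) (by nlinarith) (by ring)
      (by norm_num) (by linarith) (by linarith) (by linarith) (a (by simp)) ?_ ?_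
    · rw [e0]; exact b
    · rw [e0, d, e]

/-- The reflection analysis divides by `t`, so `t = 0` is excluded separately: there `T = Q` has
spectrum inside `{0, 1}`. -/
theorem IsPencilAt.ne_zero_of_half_mem {T : H →L[ℂ] H} {t : ℝ} (h : IsPencilAt T t)
    (h2 : 1 / 2 ∈ realSpectrum T) : t ≠ 0 := by
  rintro rfl
  have := h.realSpectrum_subset_of_zero h2
  norm_num at this

theorem PosCondition.setOf_isPencilAt {T : H →L[ℂ] H} (hT : IsSelfAdjoint T) {z : ℝ}
    (h : PosCondition T z) : {t | IsPencilAt T t} = {z, z + 1 / 2} := by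
  refine Set.Subset.antisymm (fun t ht => ?_) ?_
  · have h0 := ht.ne_zero_of_half_mem (h.2.1 (by simp))
    exact (ht.isPencilSet h0).eq_or_eq_of_pos h0 h.1 h.2.1 h.2.2.1
  · rintro t (rfl | rfl)
    exacts [(h.isPencilAt hT).1, (h.isPencilAt hT).2]

theorem NegCondition.setOf_isPencilAt {T : H →L[ℂ] H} (hT : IsSelfAdjoint T) {z : ℝ}
    (h : NegCondition T z) : {t | IsPencilAt T t} = {z, z - 1 / 2} := by
  refine Set.Subset.antisymm (fun t ht => ?_) ?_
  · have h0 := ht.ne_zero_of_half_mem (h.2.1 (by simp))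
    exact (ht.isPencilSet h0).eq_or_eq_of_neg h0 h.1 h.2.1 h.2.2.1
  · rintro t (rfl | rfl)
    exacts [(h.isPencilAt hT).1, (h.isPencilAt hT).2]

theorem exists_posCondition_or_negCondition {T : H →L[ℂ] H} (hT : IsSelfAdjoint T)
    (h : ∃ l m : ℝ, l ≠ 0 ∧ m ≠ 0 ∧ |l - m| = 1 / 2 ∧ max l m ≠ 1 ∧ min l m ≠ -1 ∧
      IsPencilAt T l ∧ IsPencilAt T m) :
    (∃ z, PosCondition T z) ∨ ∃ z, NegCondition T z := by
  obtain ⟨l, m, hl, hm, hlm, hmax, hmin, h1, h2⟩ := h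
  rcases (abs_eq (by norm_num)).1 hlm with e | e
  · obtain rfl : l = m + 1 / 2 := by linarith
    rw [max_eq_left (by linarith)] at hmax
    rw [min_eq_right (by linarith)] at hmin
    exact posCondition_or_negCondition hT hm hl hmax hmin h2 h1
  · obtain rfl : m = l + 1 / 2 := by linarith
    rw [max_eq_right (by linarith)] at hmax
    rw [min_eq_left (by linarith)] at hmin
    exact posCondition_or_negCondition hT hl hm hmax hmin h1 h2

theorem posCondition_iff {T : H →L[ℂ] H} (hT : IsSelfAdjoint T) {z : ℝ} :
    PosCondition T z ↔ 1 / 2 < z ∧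
      ({1 / 2, 1 / 2 + (z : ℂ), 1 + (z : ℂ)} : Set ℂ) ⊆ spectrum ℂ T ∧
      spectrum ℂ T ⊆ {1 / 2, 1 / 2 + (z : ℂ), 1 + (z : ℂ), 0, 1} ∧
      nullDim T (1 / 2) = nullDim T (1 / 2 + z) ∧
      nullDim T (1 / 2 + z) = nullDim T (1 + z) := by
  rw [PosCondition, ← image_subset_spectrum_iff, ← spectrum_subset_image_iff hT]
  simp only [Set.image_insert_eq, Set.image_singleton]
  push_cast
  rfl

theorem negCondition_iff {T : H →L[ℂ] H} (hT : IsSelfAdjoint T) {z : ℝ} :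
    NegCondition T z ↔ z < -(1 / 2) ∧
      ({1 / 2, (z : ℂ), 1 / 2 + (z : ℂ)} : Set ℂ) ⊆ spectrum ℂ T ∧
      spectrum ℂ T ⊆ {1 / 2, (z : ℂ), 1 / 2 + (z : ℂ), 0, 1} ∧
      nullDim T (1 / 2) = nullDim T (1 / 2 + z) ∧
      nullDim T (1 / 2 + z) = nullDim T z := by
  rw [NegCondition, ← image_subset_spectrum_iff, ← spectrum_subset_image_iff hT]
  simp only [Set.image_insert_eq, Set.image_singleton]
  push_cast
  rfl

end

theorem proposition3p4 {H : Type u} [NormedAddCommGroup H] [InnerProductSpace ℂ H]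
    [CompleteSpace H] (T : H →L[ℂ] H) (hT : IsSelfAdjoint T) :
    ((∃ l m : ℝ, l ≠ 0 ∧ m ≠ 0 ∧ |l - m| = 1 / 2 ∧ max l m ≠ 1 ∧ min l m ≠ -1 ∧
        IsPencilAt T l ∧ IsPencilAt T m) ↔
      ((∃ z : ℝ, 1 / 2 < z ∧
          ({1 / 2, 1 / 2 + (z : ℂ), 1 + (z : ℂ)} : Set ℂ) ⊆ spectrum ℂ T ∧
          spectrum ℂ T ⊆ {1 / 2, 1 / 2 + (z : ℂ), 1 + (z : ℂ), 0, 1} ∧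
          nullDim T (1 / 2) = nullDim T (1 / 2 + z) ∧
          nullDim T (1 / 2 + z) = nullDim T (1 + z)) ∨
        (∃ z : ℝ, z < -(1 / 2) ∧
          ({1 / 2, (z : ℂ), 1 / 2 + (z : ℂ)} : Set ℂ) ⊆ spectrum ℂ T ∧
          spectrum ℂ T ⊆ {1 / 2, (z : ℂ), 1 / 2 + (z : ℂ), 0, 1} ∧
          nullDim T (1 / 2) = nullDim T (1 / 2 + z) ∧
          nullDim T (1 / 2 + z) = nullDim T z))) ∧
    ((∃ l m : ℝ, l ≠ 0 ∧ m ≠ 0 ∧ |l - m| = 1 / 2 ∧ max l m ≠ 1 ∧ min l m ≠ -1 ∧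
        IsPencilAt T l ∧ IsPencilAt T m) →
      {t : ℝ | IsPencilAt T t}.ncard = 2) := by
  simp only [← posCondition_iff hT, ← negCondition_iff hT]
  refine ⟨⟨exists_posCondition_or_negCondition hT, ?_⟩, fun h => ?_⟩
  · rintro (⟨z, h⟩ | ⟨z, h⟩)
    · have hz := h.1
      obtain ⟨h1, h2⟩ := h.isPencilAt hT
      refine ⟨z, z + 1 / 2, by linarith, by linarith, by norm_num, ?_, ?_, h1, h2⟩
      · rw [max_eq_right (by linarith)]; linarith
      · rw [min_eq_left (by linarith)]; linarith
    · have hz := h.1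
      obtain ⟨h1, h2⟩ := h.isPencilAt hT
      refine ⟨z, z - 1 / 2, by linarith, by linarith, by norm_num, ?_, ?_, h1, h2⟩
      · rw [max_eq_left (by linarith)]; linarith
      · rw [min_eq_right (by linarith)]; linarith
  · rcases exists_posCondition_or_negCondition hT h with ⟨z, hz⟩ | ⟨z, hz⟩
    · rw [hz.setOf_isPencilAt hT]
      exact Set.ncard_pair (by linarith)
    · rw [hz.setOf_isPencilAt hT]
      exact Set.ncard_pair (by linarith)
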